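/- Let $N\ge 1$ and, for $0\le k\le N$, let $|S_k^N\rangle\in(\mathbb C^2)^{\otimes N}$ be the Dicke vector, i.e. $\binom Nk^{-1/2}$ times the sum of the $\binom Nk$ distinct permutations of $|0\rangle^{\otimes k}\otimes|1\rangle^{\otimes(N-k)}$. Let $\mathbb 1_{\mathcal S}$ be the orthogonal projection of $(\mathbb C^2)^{\otimes N}$ onto the span of $|S_0^N\rangle,\dots,|S_N^N\rangle$ (the symmetric subspace). For real numbers $p_0,\dots,p_N$ put $\rho_{DS}(p)=\sum_{k=0}^N p_k|S_k^N\rangle\langle S_k^N|$, and for $l\in\{0,1\}$, $n_l=\lfloor (N-l)/2\rfloor$, let $$M_l(p)=\left[\frac{p_{i+j+l}}{\binom{N}{i+j+l}}\right]_{0\le i,j\le n_l}.$$ For $\alpha\in\mathbb R$ let $\Lambda_\alpha(\rho)=\mathrm{Tr}(\rho)\,\mathbb 1_{\mathcal S}+\alpha\rho$, a linear map on operators on $(\mathbb C^2)^{\otimes N}$. A (not necessarily normalized) operator $\sigma$ is called separable if it is a finite sum $\sum_m w_m|\Psi_m\rangle\langle\Psi_m|$ with $w_m\ge 0$ and $\Psi_m=e_{m,1}\otimes\dots\otimes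 e_{m,N}$ products of unit vectors of $\mathbb C^2$; a state is a positive semidefinite operator of trace one. Write $1+\alpha p$ for the sequence $(1+\alpha p_k)_{k=0}^N$. Then for every $\alpha\in\mathbb R$: 1. If $\rho_{DS}(p)$ is a state, then $\Lambda_\alpha(\rho_{DS}(p))=\rho_{DS}(1+\alpha p)$. 2. If $\rho_{DS}(p)$ is a state and the two matrices $M_0(1+\alpha p)$ and $M_1(1+\alpha p)$ are positive semidefinite, then $\sigma_{DS}=\Lambda_\alpha(\rho_{DS}(p))$ is separable. 3. Suppose $\alpha\ne 0$ and $\alpha\neq-(N+1)$. Then $\Lambda_\alpha$ is invertible, and for every diagonal symmetric operator $\sigma_{DS}=\rho_{DS}(q)\ge 0$: (a) if $\Lambda_\alpha^{-1}(\sigma_{DS})=\rho_{DS}(p)$ is a state for which $M_0(1+\alpha p)$ and $M_1(1+\alpha p)$ are positive semidefinite, then $\sigma_{DS}$ is separable; (b) if $\alpha$ is such that $M_0(1+\alpha p)$ and $M_1(1+\alpha p)$ are positive semidefinite for every state $\rho_{DS}(p)$, and if $\Lambda_\alpha^{-1}(\sigma_{DS})\ge 0$, then $\sigma_{DS}$ is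 separable. -/

import Mathlib

open scoped Matrix ComplexOrder

noncomputable section

namespace DickeSep

/-- Bit strings labelling the computational basis of `(ℂ²)^{⊗N}`. -/
abbrev Str (N : ℕ) : Type := Fin N → Fin 2

/-- Operators on `(ℂ²)^{⊗N}`, as matrices in the computational basis. -/
abbrev Op (N : ℕ) : Type := Matrix (Str N) (Str N) ℂ

/-- The rank-one operator `|v⟩⟨v|`. -/
def ketBra {N : ℕ} (v : EuclideanSpace ℂ (Str N)) : Op N :=
  Matrix.vecMulVec (fun s => v s) (fun s => star (v s))

/-- The product vector `e₁ ⊗ ⋯ ⊗ e_N`. -/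
def productVec {N : ℕ} (e : Fin N → EuclideanSpace ℂ (Fin 2)) : EuclideanSpace ℂ (Str N) :=
  WithLp.toLp 2 (fun s => ∏ i, e i (s i))

/-- Separability: a finite mixture, with nonnegative weights, of projectors onto product unit
vectors. Operators need not be normalized; the weights add up to the trace of `σ`, so for `σ` of
trace one this is a convex combination of pure product states. -/
def IsSeparable {N : ℕ} (σ : Op N) : Prop :=
  ∃ (K : ℕ) (w : Fin K → ℝ) (e : Fin K → Fin N → EuclideanSpace ℂ (Fin 2)),
    (∀ m, 0 ≤ w m) ∧ (∀ m i, ‖e m i‖ = 1) ∧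
      σ = ∑ m, (w m : ℂ) • ketBra (productVec (e m))

/-- A density operator: positive semidefinite with trace one. -/
def IsState {N : ℕ} (ρ : Op N) : Prop := ρ.PosSemidef ∧ ρ.trace = 1

/-- The Dicke vector `|S_k^N⟩`: the normalized equal superposition of the `N.choose k` distinct
permutations of `|0⟩^{⊗k} ⊗ |1⟩^{⊗(N-k)}`. -/
def dickeVec (N k : ℕ) : EuclideanSpace ℂ (Str N) :=
  WithLp.toLp 2 (fun s =>
    if (Finset.univ.filter (fun i => s i = 0)).card = k
    then (((Real.sqrt (N.choose k))⁻¹ : ℝ) : ℂ) else 0)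

/-- The symmetric subspace: the span of the Dicke vectors `|S_0^N⟩, …, |S_N^N⟩`. -/
def symSubspace (N : ℕ) : Submodule ℂ (EuclideanSpace ℂ (Str N)) :=
  Submodule.span ℂ (Set.range (fun k : Fin (N + 1) => dickeVec N k))

/-- The identity of the symmetric subspace, as an operator on `(ℂ²)^{⊗N}`: the matrix of the
orthogonal projection onto the symmetric subspace. -/
def symId (N : ℕ) : Op N :=
  (Matrix.toEuclideanCLM (n := Str N) (𝕜 := ℂ)).symm (symSubspace N).starProjection

/-- The diagonal symmetric operator `∑_{k=0}^N p_k |S_k^N⟩⟨S_k^N|`. Only `p 0, …, p N` matter. -/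
def dickeDiag (N : ℕ) (p : ℕ → ℝ) : Op N :=
  ∑ k ∈ Finset.range (N + 1), (p k : ℂ) • ketBra (dickeVec N k)

/-- The map `Λ_α(ρ) = Tr(ρ) 𝟙_S + α ρ`. -/
def reductionMap (N : ℕ) (α : ℝ) : Module.End ℂ (Op N) :=
  (Matrix.traceLinearMap (Str N) ℂ ℂ).smulRight (symId N) + (α : ℂ) • LinearMap.id

/-- The Hankel matrix `M_l(p)` of size `n_l + 1`, `n_l = ⌊(N - l)/2⌋`, with `(i, j)` entry
`p_{i+j+l} / (N choose (i+j+l))`. For `l ≤ 1 ≤ N` all indices occurring are at most `N`. -/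
def hankel (N l : ℕ) (p : ℕ → ℝ) : Matrix (Fin ((N - l) / 2 + 1)) (Fin ((N - l) / 2 + 1)) ℝ :=
  Matrix.of fun i j => p (i + j + l) / (N.choose (i + j + l) : ℝ)

end DickeSep

end

/-!
The image `Λ_α(ρ_DS(p))` is again diagonal symmetric, because the identity of the symmetric subspace
is `ρ_DS(1, …, 1)` (`symId_eq_dickeDiag`, by orthonormality of the Dicke vectors). So everything
rests on one criterion, `isSeparable_dickeDiag`: if the two Hankel matrices of the sequence
`a k = q k / (N choose k)` are positive semidefinite, then `ρ_DS(q)` is separable.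

The criterion is a truncated Stieltjes moment problem. A polynomial positive on `[0, ∞)` has the
form `σ₀ + X σ₁` with sums of squares `σ₀`, `σ₁` (`exists_polya_szego`), and the functional
`X ^ k ↦ a k` is nonnegative on `σ₀` and on `X σ₁` exactly by positivity of the two Hankel matrices.
By separation from a compact convex set, `a` then lies in the cone over the moment curve
`x ↦ (xᵏ (1 - x)^(N - k))ₖ`, `x ∈ [0, 1]` (`exists_moment_representation`). A point of this curve is
a separable operator: averaging the product state `(√x |0⟩ + √(1 - x) z |1⟩)^{⊗N}` over the
`(N + 1)`-th roots of unity `z` erases the coherences between different Dicke vectors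
(`sum_ketBra_productVec_qubit`).

`Λ_α` is injective since the trace of `Λ_α(X)` is `(N + 1 + α) Tr X`. It maps diagonal symmetric
operators onto diagonal symmetric operators, so the preimage of one is diagonal symmetric too; a
positive preimage is zero or a positive multiple of a state, which reduces the last claim to the
case of a state.
-/

namespace DickeSep

/-! ### Polynomials positive on a half-line -/

open Polynomial in
/-- A real polynomial that is positive on `ℝ` is a sum of two squares: it has no real root, so a
complex root gives a factor `(X - x)² + y²`, and sums of two squares are closed under products. -/
theorem exists_eq_sq_add_sq_of_forall_eval_pos (n : ℕ) (P : ℝ[X]) (hn : P.natDegree ≤ n)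
    (hP : ∀ t, 0 < P.eval t) :
    ∃ a b : ℝ[X], P = a ^ 2 + b ^ 2 ∧ 2 * a.natDegree ≤ P.natDegree ∧
      2 * b.natDegree ≤ P.natDegree := by
  induction n using Nat.strong_induction_on generalizing P with
  | _ n ih =>
  by_cases h0 : P.natDegree = 0
  · obtain ⟨c, rfl⟩ := natDegree_eq_zero.mp h0
    have hc : 0 < c := by simpa using hP 0
    refine ⟨C (Real.sqrt c), 0, ?_, by simp, by simp⟩
    rw [← C_pow, Real.sq_sqrt hc.le]; simp
  · have hne : P ≠ 0 := by rintro rfl; simp at h0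
    obtain ⟨z, hz⟩ := IsAlgClosed.exists_aeval_eq_zero ℂ P
      (by rw [degree_eq_natDegree hne]; exact_mod_cast h0)
    have him : z.im ≠ 0 := by
      intro him
      have hzr : z = ((z.re : ℝ) : ℂ) := Complex.ext rfl (by simpa using him)
      have h1 := hP z.re
      rw [hzr] at hz
      have h2 : aeval ((algebraMap ℝ ℂ) z.re) P = 0 := hz
      rw [aeval_algebraMap_apply, map_eq_zero] at h2
      rw [coe_aeval_eq_eval] at h2
      linarith
    obtain ⟨R, hR⟩ := P.quadratic_dvd_of_aeval_eq_zero_im_ne_zero hz him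
    set Q : ℝ[X] := X ^ 2 - C (2 * z.re) * X + C (‖z‖ ^ 2) with hQ
    have hQe : Q = (X - C z.re) ^ 2 + C z.im ^ 2 := by
      rw [hQ, Complex.sq_norm, Complex.normSq_apply]
      simp only [map_add, map_mul, C_ofNat]; ring
    have hQd : Q.natDegree = 2 := by rw [hQ]; compute_degree!
    have hRne : R ≠ 0 := by rintro rfl; simp [hR] at hne
    have hQne : Q ≠ 0 := by intro h; simp [h] at hQd
    have hdeg : P.natDegree = 2 + R.natDegree := by
      rw [hR, natDegree_mul hQne hRne, hQd]
    have hRpos : ∀ t, 0 < R.eval t := by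
      intro t
      have h1 := hP t
      rw [hR, eval_mul] at h1
      have h2 : 0 ≤ Q.eval t := by rw [hQe]; simp; positivity
      exact pos_of_mul_pos_right h1 h2
    obtain ⟨c, d, hcd, hc, hd⟩ := ih R.natDegree (by omega) R le_rfl hRpos
    have hX : (X - C z.re).natDegree = 1 := natDegree_X_sub_C _
    have hC : (C z.im : ℝ[X]).natDegree = 0 := natDegree_C _
    have bound : ∀ u v : ℝ[X], 2 * u.natDegree ≤ R.natDegree → 2 * v.natDegree ≤ R.natDegree →
        ∀ w, (w = (X - C z.re) * u - C z.im * v ∨ w = (X - C z.re) * u + C z.im * v) →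
        2 * w.natDegree ≤ P.natDegree := by
      intro u v hu hv w hw
      have h1 : ((X - C z.re) * u).natDegree ≤ 1 + u.natDegree := natDegree_mul_le.trans (by omega)
      have h2 : (C z.im * v).natDegree ≤ v.natDegree := natDegree_mul_le.trans (by omega)
      rcases hw with rfl | rfl
      · have := natDegree_sub_le ((X - C z.re) * u) (C z.im * v); omega
      · have := natDegree_add_le ((X - C z.re) * u) (C z.im * v); omega
    refine ⟨(X - C z.re) * c - C z.im * d, (X - C z.re) * d + C z.im * c, ?_,
      bound c d hc hd _ (Or.inl rfl), bound d c hd hc _ (Or.inr rfl)⟩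
    rw [hR, hQe, hcd]; ring

open Polynomial in
/-- The splitting of a polynomial into its even and odd parts. -/
theorem eq_expand_add_X_mul_expand (a : ℝ[X]) :
    a = expand ℝ 2 (contract 2 a) + X * expand ℝ 2 (contract 2 a.divX) := by
  ext n
  rcases Nat.even_or_odd' n with ⟨m, rfl | rfl⟩
  · rw [coeff_add, mul_comm 2 m, coeff_expand_mul (by norm_num), coeff_contract (by norm_num)]
    rcases m with _ | m
    · simp
    · rw [show (m + 1) * 2 = (2 * m + 1) + 1 by ring, coeff_X_mul, coeff_expand (by norm_num)]
      simp
  · rw [coeff_add, coeff_X_mul, mul_comm 2 m, coeff_expand_mul (by norm_num),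
      coeff_contract (by norm_num), coeff_divX, coeff_expand (by norm_num)]
    simp

open Polynomial in
theorem eq_of_expand_eq_expand_add_X_mul_expand {A B D : ℝ[X]}
    (h : expand ℝ 2 A = expand ℝ 2 B + X * expand ℝ 2 D) : A = B := by
  ext m
  have h1 := congrArg (fun p => p.coeff (m * 2)) h
  simp only [coeff_add] at h1
  rw [coeff_expand_mul (by norm_num), coeff_expand_mul (by norm_num)] at h1
  rcases m with _ | m
  · simpa using h1
  · rw [h1, show (m + 1) * 2 = (m * 2 + 1) + 1 by ring, coeff_X_mul, coeff_expand (by norm_num),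
      if_neg (by omega), add_zero]

open Polynomial in
theorem natDegree_contract_two_le {a : ℝ[X]} {n : ℕ} (h : a.natDegree ≤ n) :
    (contract 2 a).natDegree ≤ n / 2 := by
  rw [natDegree_le_iff_coeff_eq_zero]
  intro k hk
  rw [coeff_contract (by norm_num)]
  exact coeff_eq_zero_of_natDegree_lt (by omega)

open Polynomial in
/-- The Pólya–Szegő representation of a polynomial positive on `[0, ∞)`, with the degree bounds
that match the sizes of the two Hankel matrices. It is the even part of a representation of
`p (X²)` as a sum of two squares. -/
theorem exists_polya_szego {N : ℕ} (p : ℝ[X]) (hN : p.natDegree ≤ N)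
    (hp : ∀ t, 0 ≤ t → 0 < p.eval t) :
    ∃ u₁ u₂ v₁ v₂ : ℝ[X], p = (u₁ ^ 2 + u₂ ^ 2) + X * (v₁ ^ 2 + v₂ ^ 2) ∧
      u₁.natDegree ≤ N / 2 ∧ u₂.natDegree ≤ N / 2 ∧
      v₁.natDegree ≤ (N - 1) / 2 ∧ v₂.natDegree ≤ (N - 1) / 2 := by
  obtain ⟨a, b, hab, ha, hb⟩ := exists_eq_sq_add_sq_of_forall_eval_pos _ (expand ℝ 2 p) le_rfl
    (fun t => by rw [expand_eval]; exact hp _ (by positivity))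
  rw [natDegree_expand] at ha hb
  refine ⟨contract 2 a, contract 2 b, contract 2 a.divX, contract 2 b.divX, ?_,
    natDegree_contract_two_le (by omega), natDegree_contract_two_le (by omega),
    natDegree_contract_two_le (by rw [natDegree_divX_eq_natDegree_tsub_one]; omega),
    natDegree_contract_two_le (by rw [natDegree_divX_eq_natDegree_tsub_one]; omega)⟩
  apply eq_of_expand_eq_expand_add_X_mul_expand
    (D := 2 * contract 2 a * contract 2 a.divX + 2 * contract 2 b * contract 2 b.divX)
  rw [hab]
  conv_lhs => rw [eq_expand_add_X_mul_expand a, eq_expand_add_X_mul_expand b]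
  simp only [map_add, map_mul, map_pow, expand_X, map_ofNat]
  ring

end DickeSep

namespace DickeSep

/-! ### The truncated Stieltjes moment problem -/

/-- In finite dimension the convex hull of a compact set is compact: by Carathéodory it is the
image of a product of compact sets. -/
theorem isCompact_convexHull_of_isCompact {E : Type*} [NormedAddCommGroup E] [NormedSpace ℝ E]
    [FiniteDimensional ℝ E] {s : Set E} (hs : IsCompact s) : IsCompact (convexHull ℝ s) := by
  rcases s.eq_empty_or_nonempty with rfl | ⟨x₀, hx₀⟩
  · simp
  set d := Module.finrank ℝ E + 1
  have hK : IsCompact (stdSimplex ℝ (Fin d) ×ˢ Set.univ.pi (fun _ : Fin d => s)) :=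
    (isCompact_stdSimplex ℝ (Fin d)).prod (isCompact_univ_pi fun _ => hs)
  have hc : Continuous (fun q : (Fin d → ℝ) × (Fin d → E) => ∑ i, q.1 i • q.2 i) := by fun_prop
  convert hK.image hc using 1
  ext x
  constructor
  · intro hx
    obtain ⟨ι, _, z, w, hz, hind, hw, hw1, rfl⟩ := eq_pos_convex_span_of_mem_convexHull hx
    have hcard : Fintype.card ι ≤ Fintype.card (Fin d) := by
      rw [Fintype.card_fin]
      exact hind.card_le_finrank_succ.trans (Nat.succ_le_succ (Submodule.finrank_le _))
    obtain ⟨e⟩ := Function.Embedding.nonempty_of_card_le hcard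
    have hw0 : ∀ i, i ∉ Set.range e → Function.extend e w 0 i = 0 := fun i hi => by
      rw [Function.extend_apply' _ _ _ hi]; rfl
    refine ⟨(Function.extend e w 0, Function.extend e z (fun _ => x₀)), ⟨⟨fun i => ?_, ?_⟩, ?_⟩, ?_⟩
    · by_cases hi : i ∈ Set.range e
      · obtain ⟨j, rfl⟩ := hi
        simpa [e.injective.extend_apply] using (hw j).le
      · simpa using (hw0 i hi).ge
    · rw [← hw1]
      exact (Fintype.sum_of_injective e e.injective _ _ hw0
        fun i => (e.injective.extend_apply _ _ _).symm).symm
    · intro i _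
      by_cases hi : i ∈ Set.range e
      · obtain ⟨j, rfl⟩ := hi
        simpa [e.injective.extend_apply] using hz ⟨j, rfl⟩
      · simpa [Function.extend_apply' _ _ _ hi] using hx₀
    · refine (Fintype.sum_of_injective e e.injective _ _ (fun i hi => ?_) fun i => ?_).symm
      · simp [hw0 i hi]
      · simp [e.injective.extend_apply]
  · rintro ⟨⟨w, z⟩, ⟨⟨hw, hw1⟩, hz⟩, rfl⟩
    exact mem_convexHull_of_exists_fintype w z hw hw1 (fun i => hz i trivial) rfl

/-- The homogeneous moment curve `x ↦ (xᵏ (1 - x)^(N - k))ₖ`. The parameter `x = t / (1 + t)` in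
`[0, 1]` compactifies the half-line `t ∈ [0, ∞]`, the endpoint `x = 1` standing for `t = ∞`. -/
def momentCurve (N : ℕ) (x : ℝ) : Fin (N + 1) → ℝ := fun k => x ^ (k : ℕ) * (1 - x) ^ (N - k)

theorem sum_choose_mul_momentCurve (N : ℕ) (x : ℝ) :
    ∑ k : Fin (N + 1), (N.choose k : ℝ) * momentCurve N x k = 1 := by
  have h := add_pow x (1 - x) N
  rw [Finset.sum_range] at h
  simp only [add_sub_cancel, one_pow] at h
  rw [h]
  exact Finset.sum_congr rfl fun k _ => by rw [momentCurve]; ring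

open Polynomial in
/-- The Riesz functional of the sequence `a`, i.e. the linear map with `X ^ k ↦ a k`. -/
def riesz (a : ℕ → ℝ) : ℝ[X] →ₗ[ℝ] ℝ := Polynomial.lsum fun k => a k • LinearMap.id

open Polynomial in
theorem riesz_X_pow (a : ℕ → ℝ) (k : ℕ) : riesz a (X ^ k) = a k := by
  simp [riesz, lsum_apply, X_pow_eq_monomial, sum_monomial_index]

open Polynomial in
/-- The Riesz functional is nonnegative on `Xˡ u²`, where it is the quadratic form of a shifted
Hankel matrix. -/
theorem riesz_X_pow_mul_sq_nonneg {a : ℕ → ℝ} {l m : ℕ}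
    (h : (Matrix.of fun i j : Fin (m + 1) => a (i + j + l)).PosSemidef) {u : ℝ[X]}
    (hu : u.natDegree ≤ m) : 0 ≤ riesz a (X ^ l * u ^ 2) := by
  have hsum : u = ∑ i : Fin (m + 1), u.coeff i • X ^ (i : ℕ) := by
    conv_lhs => rw [u.as_sum_range' (m + 1) (by omega), Finset.sum_range]
    simp [smul_X_eq_monomial]
  have h2 := h.dotProduct_mulVec_nonneg (fun i => u.coeff i)
  refine h2.trans_eq (Eq.symm ?_)
  have hsq : u ^ 2 = (∑ i : Fin (m + 1), u.coeff i • X ^ (i : ℕ)) ^ 2 := congrArg (· ^ 2) hsum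
  rw [hsq, sq, Finset.sum_mul_sum, Finset.mul_sum, map_sum, dotProduct]
  refine Finset.sum_congr rfl fun i _ => ?_
  rw [Finset.mul_sum, map_sum, Matrix.mulVec, dotProduct, Finset.mul_sum]
  refine Finset.sum_congr rfl fun j _ => ?_
  rw [smul_mul_smul_comm, mul_smul_comm, map_smul, ← pow_add, ← pow_add, riesz_X_pow]
  simp [add_comm]
  ring

theorem nonneg_of_posSemidef {a : ℕ → ℝ} {N : ℕ} (hN : 1 ≤ N)
    (h0 : (Matrix.of fun i j : Fin (N / 2 + 1) => a (i + j)).PosSemidef)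
    (h1 : (Matrix.of fun i j : Fin ((N - 1) / 2 + 1) => a (i + j + 1)).PosSemidef)
    {k : ℕ} (hk : k ≤ N) : 0 ≤ a k := by
  rcases Nat.even_or_odd' k with ⟨m, rfl | rfl⟩
  · simpa [two_mul] using h0.diag_nonneg (i := ⟨m, by omega⟩)
  · simpa [two_mul] using h1.diag_nonneg (i := ⟨m, by omega⟩)

open Polynomial in
/-- The truncated Stieltjes moment problem: positivity of both Hankel matrices puts the sequence
in the cone over the moment curve. A point outside the compact convex hull of the curve could be
separated from it, and the separating functional would be a polynomial positive on `[0, ∞)`, which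
contradicts the Pólya–Szegő representation. -/
theorem exists_moment_representation {a : ℕ → ℝ} {N : ℕ} (hN : 1 ≤ N)
    (h0 : (Matrix.of fun i j : Fin (N / 2 + 1) => a (i + j)).PosSemidef)
    (h1 : (Matrix.of fun i j : Fin ((N - 1) / 2 + 1) => a (i + j + 1)).PosSemidef) :
    ∃ (ι : Type) (_ : Fintype ι) (w x : ι → ℝ), (∀ m, 0 ≤ w m) ∧ (∀ m, x m ∈ Set.Icc 0 1) ∧
      ∀ k ≤ N, a k = ∑ m, w m * (x m ^ k * (1 - x m) ^ (N - k)) := by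
  have hnn := fun k hk => nonneg_of_posSemidef hN h0 h1 (k := k) hk
  set T := ∑ k : Fin (N + 1), (N.choose k : ℝ) * a k with hT
  have hterm : ∀ k : Fin (N + 1), 0 ≤ (N.choose k : ℝ) * a k := fun k =>
    mul_nonneg (Nat.cast_nonneg _) (hnn k (by omega))
  -- All `a k` are nonnegative, so total mass `T = 0` forces the sequence to vanish.
  rcases (Finset.sum_nonneg fun k _ => hterm k : 0 ≤ T).eq_or_lt with h | hTpos
  · refine ⟨Empty, inferInstance, nofun, nofun, nofun, nofun, fun k hk => ?_⟩
    have h2 := (Finset.sum_eq_zero_iff_of_nonneg fun k _ => hterm k).1 h.symm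
      ⟨k, by omega⟩ (Finset.mem_univ _)
    have h3 : (N.choose k : ℝ) ≠ 0 := by exact_mod_cast (Nat.choose_pos hk).ne'
    simpa [h3] using h2
  set S := momentCurve N '' Set.Icc 0 1 with hS
  have hcomp : IsCompact (convexHull ℝ S) := by
    refine isCompact_convexHull_of_isCompact (isCompact_Icc.image ?_)
    unfold momentCurve; fun_prop
  by_cases hmem : (fun k : Fin (N + 1) => a k / T) ∈ convexHull ℝ S
  · obtain ⟨ι, _, w, z, hw, -, hz, hsum⟩ := mem_convexHull_iff_exists_fintype.1 hmem
    choose x hx hxz using hz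
    refine ⟨ι, inferInstance, fun m => T * w m, x, fun m => mul_nonneg hTpos.le (hw m), hx,
      fun k hk => ?_⟩
    have h2 := congrFun hsum ⟨k, by omega⟩
    simp only [Finset.sum_apply, Pi.smul_apply, ← hxz, momentCurve, smul_eq_mul] at h2
    rw [eq_div_iff hTpos.ne'] at h2
    rw [← h2, Finset.sum_mul]
    exact Finset.sum_congr rfl fun m _ => by ring
  · exfalso
    obtain ⟨f, u, hfu, hub⟩ := geometric_hahn_banach_point_closed (convex_convexHull ℝ S)
      hcomp.isClosed hmem
    set c : Fin (N + 1) → ℝ := fun k => f (Pi.single k 1) with hc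
    have hf : ∀ v, f v = ∑ k, c k * v k := fun v => by
      conv_lhs => rw [pi_eq_sum_univ' v, map_sum]
      refine Finset.sum_congr rfl fun k _ => ?_
      rw [map_smul, smul_eq_mul, mul_comm]
    -- Since `∑ (N choose k) vₖ = 1` on the curve, `f v > u` there means that this polynomial is
    -- positive at `t = x / (1 - x)`.
    set p : ℝ[X] := ∑ k : Fin (N + 1), C (c k - u * N.choose k) * X ^ (k : ℕ) with hp
    have hdeg : p.natDegree ≤ N := natDegree_sum_le_of_forall_le _ _ fun k _ =>
      (natDegree_C_mul_X_pow_le _ _).trans (by omega)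
    have hpos : ∀ t, 0 ≤ t → 0 < p.eval t := by
      intro t ht
      have ht1 : 0 < 1 + t := by linarith
      have hx : t / (1 + t) ∈ Set.Icc (0 : ℝ) 1 :=
        ⟨by positivity, by rw [div_le_one ht1]; linarith⟩
      have h2 := hub _ (subset_convexHull ℝ S ⟨_, hx, rfl⟩)
      have h3 := sum_choose_mul_momentCurve N (t / (1 + t))
      have h4 : p.eval t = (1 + t) ^ N * (f (momentCurve N (t / (1 + t))) - u) := by
        have h7 : u = u * ∑ k : Fin (N + 1),
            (N.choose k : ℝ) * momentCurve N (t / (1 + t)) k := by rw [h3, mul_one]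
        conv_rhs => rw [h7]
        rw [hf, Finset.mul_sum, ← Finset.sum_sub_distrib, Finset.mul_sum, hp, eval_finsetSum]
        refine Finset.sum_congr rfl fun k _ => ?_
        have h5 : (1 + t) ^ N = (1 + t) ^ (k : ℕ) * (1 + t) ^ (N - k) := by
          rw [← pow_add]; congr 1; omega
        have h6 : 1 - t / (1 + t) = 1 / (1 + t) := by field_simp; ring
        rw [momentCurve, h6, h5]
        simp only [eval_mul, eval_C, eval_pow, eval_X, div_pow, one_pow]
        field_simp
      rw [h4]
      exact mul_pos (by positivity) (by linarith)
    obtain ⟨u₁, u₂, v₁, v₂, hrep, hu₁, hu₂, hv₁, hv₂⟩ := exists_polya_szego p hdeg hpos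
    have hL : 0 ≤ riesz a p := by
      rw [hrep, mul_add, map_add, map_add, map_add]
      have e := fun {q : ℝ[X]} hq => riesz_X_pow_mul_sq_nonneg (l := 0) (a := a) (u := q) h0 hq
      have o := fun {q : ℝ[X]} hq => riesz_X_pow_mul_sq_nonneg (l := 1) (a := a) (u := q) h1 hq
      simp only [pow_zero, one_mul, pow_one] at e o
      have := e hu₁; have := e hu₂; have := o hv₁; have := o hv₂
      linarith
    have hL2 : riesz a p = T * (f (fun k => a k / T) - u) := by
      rw [hp, map_sum, mul_sub, hf, Finset.mul_sum, mul_comm T u, hT, Finset.mul_sum, ← hT,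
        ← Finset.sum_sub_distrib]
      refine Finset.sum_congr rfl fun k _ => ?_
      rw [← smul_eq_C_mul, map_smul, riesz_X_pow, smul_eq_mul]
      have hTne : T ≠ 0 := ne_of_gt hTpos
      field_simp
    rw [hL2] at hL
    exact absurd (nonneg_of_mul_nonneg_right hL hTpos) (by linarith)

end DickeSep

noncomputable section
namespace DickeSep

/-! ### Matrix entries of diagonal symmetric operators -/

/-- The number of zeros in a bit string, i.e. the index of the Dicke vector containing it. -/
def zeroCount {N : ℕ} (s : Str N) : ℕ := (Finset.univ.filter (fun i => s i = 0)).card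

theorem zeroCount_le {N : ℕ} (s : Str N) : zeroCount s ≤ N := by
  simpa [zeroCount] using Finset.card_filter_le (Finset.univ : Finset (Fin N)) (fun i => s i = 0)

theorem card_filter_zeroCount_eq (N k : ℕ) :
    (Finset.univ.filter (fun s : Str N => zeroCount s = k)).card = N.choose k := by
  have h : (Finset.powersetCard k (Finset.univ : Finset (Fin N))).card = N.choose k := by simp
  rw [← h]
  refine Finset.card_nbij' (fun s => Finset.univ.filter (fun i => s i = 0))
    (fun A i => if i ∈ A then 0 else 1) ?_ ?_ ?_ ?_
  · intro s hs
    have h1 : zeroCount s = k := by simpa using hs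
    simpa [zeroCount, Finset.mem_powersetCard] using h1
  · intro A hA
    have h1 : A.card = k := by simpa [Finset.mem_powersetCard] using hA
    exact Finset.mem_coe.2 (Finset.mem_filter.2 ⟨Finset.mem_univ _, by simp [zeroCount, h1]⟩)
  · intro s _
    funext i
    by_cases hi : s i = 0
    · simp [hi]
    · have h1 : s i = 1 := by omega
      simp [h1]
  · intro A _
    ext i
    simp

theorem prod_apply_str {N : ℕ} (f : Fin 2 → ℂ) (s : Str N) :
    ∏ i, f (s i) = f 0 ^ zeroCount s * f 1 ^ (N - zeroCount s) := by
  have h : ∀ i, f (s i) = if s i = 0 then f 0 else f 1 := fun i => by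
    split_ifs with hi
    · rw [hi]
    · rw [show s i = 1 by omega]
  have hc := Finset.card_filter_add_card_filter_not (s := (Finset.univ : Finset (Fin N)))
    (fun i => s i = 0)
  simp only [Finset.card_univ, Fintype.card_fin] at hc
  rw [Finset.prod_congr rfl fun i _ => h i, Finset.prod_ite, Finset.prod_const, Finset.prod_const,
    zeroCount]
  congr 2
  omega

theorem dickeVec_apply (N k : ℕ) (s : Str N) :
    dickeVec N k s = if zeroCount s = k then (((Real.sqrt (N.choose k))⁻¹ : ℝ) : ℂ) else 0 := rfl

theorem dickeDiag_apply (N : ℕ) (p : ℕ → ℝ) (s t : Str N) :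
    dickeDiag N p s t =
      if zeroCount s = zeroCount t then ((p (zeroCount s) / N.choose (zeroCount s) : ℝ) : ℂ)
      else 0 := by
  simp only [dickeDiag, Matrix.sum_apply, Matrix.smul_apply, ketBra, Matrix.vecMulVec_apply,
    dickeVec_apply, smul_eq_mul]
  rw [Finset.sum_eq_single (zeroCount s)]
  · have h0 : (0 : ℝ) ≤ N.choose (zeroCount s) := Nat.cast_nonneg _
    by_cases h : zeroCount s = zeroCount t
    · rw [if_pos rfl, if_pos h.symm, if_pos h]
      have h1 : (Real.sqrt (N.choose (zeroCount s)))⁻¹ * (Real.sqrt (N.choose (zeroCount s)))⁻¹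
          = (N.choose (zeroCount s) : ℝ)⁻¹ := by rw [← mul_inv, Real.mul_self_sqrt h0]
      rw [Complex.star_def, Complex.conj_ofReal, ← Complex.ofReal_mul, h1, ← Complex.ofReal_mul,
        div_eq_mul_inv]
    · rw [if_neg (Ne.symm h), if_neg h]; simp
  · intro k _ hk
    rw [if_neg hk.symm]; simp
  · intro h
    exact absurd (Finset.mem_range.2 (Nat.lt_succ_of_le (zeroCount_le s))) h

/-- Sums over bit strings of a function of the number of zeros. -/
theorem sum_zeroCount {M : Type*} [AddCommMonoid M] (N : ℕ) (f : ℕ → M) :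
    ∑ s : Str N, f (zeroCount s) = ∑ k ∈ Finset.range (N + 1), N.choose k • f k := by
  rw [← Finset.sum_fiberwise_of_maps_to (s := Finset.univ) (t := Finset.range (N + 1))
    (g := fun s : Str N => zeroCount s)
    (fun s _ => Finset.mem_range.2 (Nat.lt_succ_of_le (zeroCount_le s)))]
  refine Finset.sum_congr rfl fun k _ => ?_
  rw [Finset.sum_congr rfl (g := fun _ => f k) fun s hs => by rw [(Finset.mem_filter.1 hs).2],
    Finset.sum_const, card_filter_zeroCount_eq]

theorem trace_dickeDiag (N : ℕ) (p : ℕ → ℝ) :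
    (dickeDiag N p).trace = ((∑ k ∈ Finset.range (N + 1), p k : ℝ) : ℂ) := by
  simp only [Matrix.trace, Matrix.diag_apply, dickeDiag_apply, if_true]
  rw [sum_zeroCount N (fun k => ((p k / N.choose k : ℝ) : ℂ)), Complex.ofReal_sum]
  refine Finset.sum_congr rfl fun k hk => ?_
  have h : (N.choose k : ℂ) ≠ 0 := by
    exact_mod_cast (Nat.choose_pos (Nat.lt_succ_iff.1 (Finset.mem_range.1 hk))).ne'
  rw [nsmul_eq_mul, Complex.ofReal_div, Complex.ofReal_natCast, mul_div_cancel₀ _ h]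

theorem dickeDiag_add (N : ℕ) (p q : ℕ → ℝ) :
    dickeDiag N (fun k => p k + q k) = dickeDiag N p + dickeDiag N q := by
  simp [dickeDiag, add_smul, Finset.sum_add_distrib]

theorem dickeDiag_smul (N : ℕ) (c : ℝ) (p : ℕ → ℝ) :
    dickeDiag N (fun k => c * p k) = (c : ℂ) • dickeDiag N p := by
  simp [dickeDiag, mul_smul, Finset.smul_sum]

/-! ### The identity of the symmetric subspace and the map `Λ_α` -/

theorem inner_dickeVec {N k : ℕ} (hk : k ≤ N) (l : ℕ) :
    inner ℂ (dickeVec N k) (dickeVec N l) = if k = l then 1 else 0 := by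
  simp only [PiLp.inner_apply, dickeVec_apply]
  rw [sum_zeroCount N (fun m => inner ℂ (if m = k then (((Real.sqrt (N.choose k))⁻¹ : ℝ) : ℂ) else 0)
    (if m = l then (((Real.sqrt (N.choose l))⁻¹ : ℝ) : ℂ) else 0)), Finset.sum_eq_single k]
  · by_cases h : k = l
    · subst h
      have h0 : (0 : ℝ) < N.choose k := by exact_mod_cast Nat.choose_pos hk
      have h1 : (N.choose k : ℝ) *
          ((Real.sqrt (N.choose k))⁻¹ * (Real.sqrt (N.choose k))⁻¹) = 1 := by
        rw [← mul_inv, Real.mul_self_sqrt h0.le, mul_inv_cancel₀ h0.ne']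
      rw [if_pos rfl, if_pos rfl, RCLike.inner_apply, Complex.conj_ofReal, nsmul_eq_mul]
      exact_mod_cast h1
    · simp [h]
  · intro m _ hm
    simp [hm]
  · intro h
    exact absurd (Finset.mem_range.2 (Nat.lt_succ_of_le hk)) h

theorem toEuclideanCLM_ketBra {N : ℕ} (v u : EuclideanSpace ℂ (Str N)) :
    Matrix.toEuclideanCLM (n := Str N) (𝕜 := ℂ) (ketBra v) u = inner ℂ v u • v := by
  ext s
  simp only [Matrix.ofLp_toEuclideanCLM, Matrix.mulVec, dotProduct, ketBra, Matrix.vecMulVec_apply,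
    PiLp.smul_apply, PiLp.inner_apply, RCLike.inner_apply, smul_eq_mul, Finset.sum_mul]
  refine Finset.sum_congr rfl fun t _ => ?_
  rw [Complex.star_def]; ring

theorem symId_eq_dickeDiag (N : ℕ) : symId N = dickeDiag N (fun _ => 1) := by
  rw [symId, StarAlgEquiv.symm_apply_eq]
  ext1 u
  have hP : Matrix.toEuclideanCLM (n := Str N) (𝕜 := ℂ) (dickeDiag N fun _ => 1) u =
      ∑ k ∈ Finset.range (N + 1), inner ℂ (dickeVec N k) u • dickeVec N k := by
    simp only [dickeDiag, Complex.ofReal_one, one_smul, map_sum, sum_apply,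
      toEuclideanCLM_ketBra]
  rw [hP]
  refine Submodule.eq_starProjection_of_mem_orthogonal
    (Submodule.sum_mem _ fun k hk => Submodule.smul_mem _ _
      (Submodule.subset_span ⟨⟨k, Finset.mem_range.1 hk⟩, rfl⟩)) ?_
  rw [symSubspace, ← Submodule.span_singleton_le_iff_mem, Submodule.le_orthogonal_iff_le_orthogonal,
    Submodule.span_le]
  rintro _ ⟨l, rfl⟩
  rw [SetLike.mem_coe, Submodule.mem_orthogonal_singleton_iff_inner_left]
  have hl : (l : ℕ) ≤ N := Nat.lt_succ_iff.1 l.2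
  rw [inner_sub_right, inner_sum]
  simp only [inner_smul_right, inner_dickeVec hl]
  simp [hl]

theorem reductionMap_apply (N : ℕ) (α : ℝ) (X : Op N) :
    reductionMap N α X = X.trace • symId N + (α : ℂ) • X := by
  simp [reductionMap]

theorem reductionMap_dickeDiag (N : ℕ) (α : ℝ) (p : ℕ → ℝ) :
    reductionMap N α (dickeDiag N p) =
      dickeDiag N (fun k => (∑ j ∈ Finset.range (N + 1), p j) + α * p k) := by
  rw [reductionMap_apply, trace_dickeDiag, symId_eq_dickeDiag, ← dickeDiag_smul, ← dickeDiag_smul,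
    ← dickeDiag_add]
  simp

theorem isUnit_reductionMap {N : ℕ} {α : ℝ} (hα : α ≠ 0) (hα' : (N : ℝ) + 1 + α ≠ 0) :
    IsUnit (reductionMap N α) := by
  rw [LinearMap.isUnit_iff_ker_eq_bot, LinearMap.ker_eq_bot']
  intro X hX
  rw [reductionMap_apply, symId_eq_dickeDiag] at hX
  have h1 := congrArg Matrix.trace hX
  rw [Matrix.trace_add, Matrix.trace_smul, Matrix.trace_smul, trace_dickeDiag] at h1
  have h2 : X.trace * (((N : ℝ) + 1 + α : ℝ) : ℂ) = 0 := by
    simp at h1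
    push_cast
    rw [← h1]; ring
  have h3 : X.trace = 0 := (mul_eq_zero.1 h2).resolve_right (by exact_mod_cast hα')
  rw [h3, zero_smul, zero_add] at hX
  exact (smul_eq_zero.1 hX).resolve_left (by exact_mod_cast hα)

/-! ### Separability of diagonal symmetric operators -/

theorem isSeparable_of_fintype {N : ℕ} {ι : Type*} [Fintype ι] {σ : Op N} (w : ι → ℝ)
    (e : ι → Fin N → EuclideanSpace ℂ (Fin 2)) (hw : ∀ m, 0 ≤ w m) (he : ∀ m i, ‖e m i‖ = 1)
    (hσ : σ = ∑ m, (w m : ℂ) • ketBra (productVec (e m))) : IsSeparable σ := by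
  let f := (Fintype.equivFin ι).symm
  exact ⟨Fintype.card ι, w ∘ f, e ∘ f, fun m => hw _, fun m => he _,
    hσ.trans (f.sum_comp fun m => (w m : ℂ) • ketBra (productVec (e m))).symm⟩

theorem IsSeparable.smul {N : ℕ} {σ : Op N} (h : IsSeparable σ) {c : ℝ} (hc : 0 ≤ c) :
    IsSeparable ((c : ℂ) • σ) := by
  obtain ⟨K, w, e, hw, he, rfl⟩ := h
  refine ⟨K, fun m => c * w m, e, fun m => mul_nonneg hc (hw m), he, ?_⟩
  simp [Finset.smul_sum, mul_smul]

/-- Orthogonality of the characters of the group of `n`-th roots of unity. -/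
theorem sum_pow_mul_star_pow {n : ℕ} {ζ : ℂ} (hζ : IsPrimitiveRoot ζ n) (hn : n ≠ 0) {a b : ℕ}
    (ha : a < n) (hb : b < n) :
    ∑ j : Fin n, (ζ ^ (j : ℕ)) ^ a * star ((ζ ^ (j : ℕ)) ^ b) = if a = b then (n : ℂ) else 0 := by
  have hnorm : ‖ζ‖ = 1 := hζ.norm'_eq_one hn
  have hζ1 : ζ * star ζ = 1 := by
    rw [Complex.star_def, Complex.mul_conj, Complex.normSq_eq_norm_sq, hnorm]; simp
  set r := ζ ^ a * star ζ ^ b with hr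
  have hsum : ∑ j : Fin n, (ζ ^ (j : ℕ)) ^ a * star ((ζ ^ (j : ℕ)) ^ b) =
      ∑ j ∈ Finset.range n, r ^ j := by
    rw [Finset.sum_range]
    refine Finset.sum_congr rfl fun j _ => ?_
    rw [hr, mul_pow, star_pow, star_pow, ← pow_mul, ← pow_mul, ← pow_mul, ← pow_mul,
      mul_comm a, mul_comm b]
  rw [hsum]
  split_ifs with h
  · have h1 : r = 1 := by rw [hr, h, ← mul_pow, hζ1, one_pow]
    simp [h1]
  · have hr1 : r ≠ 1 := fun h1 => h <| hζ.pow_inj ha hb <| by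
      calc ζ ^ a = ζ ^ a * (star ζ ^ b * ζ ^ b) := by
            rw [← mul_pow, mul_comm (star ζ), hζ1, one_pow, mul_one]
        _ = r * ζ ^ b := by rw [hr]; ring
        _ = ζ ^ b := by rw [h1, one_mul]
    have hrn : r ^ n = 1 := by
      rw [hr, mul_pow, ← pow_mul, ← pow_mul, mul_comm a, mul_comm b, pow_mul, pow_mul, ← star_pow,
        hζ.pow_eq_one]
      simp
    rw [geom_sum_eq hr1, hrn]; simp

/-- The qubit vector `√x |0⟩ + √(1 - x) z |1⟩`. -/
def qubit (x : ℝ) (z : ℂ) : EuclideanSpace ℂ (Fin 2) :=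
  !₂[(Real.sqrt x : ℂ), (Real.sqrt (1 - x) : ℂ) * z]

theorem norm_qubit {x : ℝ} (hx : x ∈ Set.Icc (0 : ℝ) 1) {z : ℂ} (hz : ‖z‖ = 1) :
    ‖qubit x z‖ = 1 := by
  have h : 0 ≤ 1 - x := by linarith [hx.2]
  rw [EuclideanSpace.norm_eq, Real.sqrt_eq_one]
  simp [qubit, hz, Real.sq_sqrt hx.1, Real.sq_sqrt h]

/-- Averaging the product state `e^{⊗N}`, `e = √x |0⟩ + √(1 - x) z |1⟩`, over the phases `z` with
`z ^ (N + 1) = 1` kills the matrix entries between different Dicke sectors: what is left is a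
diagonal symmetric operator whose coefficients lie on the moment curve. -/
theorem sum_ketBra_productVec_qubit {N : ℕ} {ζ : ℂ} (hζ : IsPrimitiveRoot ζ (N + 1)) {x : ℝ}
    (hx : x ∈ Set.Icc (0 : ℝ) 1) (s t : Str N) :
    ∑ j : Fin (N + 1), ketBra (productVec fun _ : Fin N => qubit x (ζ ^ (j : ℕ))) s t =
      if zeroCount s = zeroCount t then
        ((N + 1 : ℕ) : ℂ) * ((x ^ zeroCount s * (1 - x) ^ (N - zeroCount s) : ℝ) : ℂ) else 0 := by
  have hs := zeroCount_le s
  have ht := zeroCount_le t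
  have hx1 : 0 ≤ 1 - x := by linarith [hx.2]
  have hprod : ∀ (z : ℂ) (s : Str N), productVec (fun _ : Fin N => qubit x z) s =
      ((Real.sqrt x ^ zeroCount s * Real.sqrt (1 - x) ^ (N - zeroCount s) : ℝ) : ℂ) *
        z ^ (N - zeroCount s) := fun z s => by
    have h := prod_apply_str (fun b => qubit x z b) s
    have h0 : qubit x z 0 = (Real.sqrt x : ℂ) := rfl
    have h1 : qubit x z 1 = (Real.sqrt (1 - x) : ℂ) * z := rfl
    rw [productVec, PiLp.toLp_apply, h, h0, h1, mul_pow]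
    push_cast
    ring
  have hentry : ∀ z : ℂ, ketBra (productVec fun _ : Fin N => qubit x z) s t =
      ((Real.sqrt x ^ zeroCount s * Real.sqrt (1 - x) ^ (N - zeroCount s) *
        (Real.sqrt x ^ zeroCount t * Real.sqrt (1 - x) ^ (N - zeroCount t)) : ℝ) : ℂ) *
        (z ^ (N - zeroCount s) * star (z ^ (N - zeroCount t))) := fun z => by
    rw [ketBra, Matrix.vecMulVec_apply, hprod, hprod, star_mul', Complex.star_def,
      Complex.conj_ofReal, mul_mul_mul_comm, ← Complex.ofReal_mul]
  rw [Finset.sum_congr rfl fun j _ => hentry _, ← Finset.mul_sum]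
  rw [sum_pow_mul_star_pow hζ (Nat.succ_ne_zero N) (by omega) (by omega)]
  by_cases h : zeroCount s = zeroCount t
  · rw [if_pos (by omega), if_pos h, ← h, mul_comm]
    congr 2
    rw [mul_mul_mul_comm, ← mul_pow, ← mul_pow, Real.mul_self_sqrt hx.1, Real.mul_self_sqrt hx1]
  · rw [if_neg (by omega), if_neg h, mul_zero]

/-- A diagonal symmetric operator with positive semidefinite Hankel matrices is separable. -/
theorem isSeparable_dickeDiag {N : ℕ} (hN : 1 ≤ N) {q : ℕ → ℝ} (h0 : (hankel N 0 q).PosSemidef)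
    (h1 : (hankel N 1 q).PosSemidef) : IsSeparable (dickeDiag N q) := by
  obtain ⟨ι, _, w, x, hw, hx, hrep⟩ :=
    exists_moment_representation (a := fun k => q k / N.choose k) hN h0 h1
  have hζ := Complex.isPrimitiveRoot_exp (N + 1) (Nat.succ_ne_zero N)
  set ζ := Complex.exp (2 * Real.pi * Complex.I / (N + 1 : ℕ))
  refine isSeparable_of_fintype (ι := ι × Fin (N + 1)) (fun m => w m.1 / (N + 1 : ℕ))
    (fun m _ => qubit (x m.1) (ζ ^ (m.2 : ℕ))) (fun m => div_nonneg (hw _) (Nat.cast_nonneg _))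
    (fun m _ => norm_qubit (hx _) (by rw [norm_pow, hζ.norm'_eq_one (Nat.succ_ne_zero N), one_pow]))
    ?_
  ext s t
  have hN1 : ((N + 1 : ℕ) : ℂ) ≠ 0 := Nat.cast_ne_zero.2 (Nat.succ_ne_zero N)
  simp only [Matrix.sum_apply, Matrix.smul_apply, Fintype.sum_prod_type, smul_eq_mul,
    ← Finset.mul_sum, sum_ketBra_productVec_qubit hζ (hx _), dickeDiag_apply]
  split_ifs with h
  · rw [hrep _ (zeroCount_le s), Complex.ofReal_sum]
    refine Finset.sum_congr rfl fun m _ => ?_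
    rw [Complex.ofReal_mul, Complex.ofReal_div, Complex.ofReal_natCast, ← mul_assoc,
      div_mul_cancel₀ _ hN1]
  · simp

theorem isSeparable_zero (N : ℕ) : IsSeparable (0 : Op N) :=
  ⟨0, nofun, nofun, nofun, nofun, by simp⟩

end DickeSep
end

/-! ### The separability criterion for the image of `Λ_α` -/

theorem mainTheorem5 (N : ℕ) (hN : 1 ≤ N) (α : ℝ) :
    -- the action of the map on diagonal symmetric states
    (∀ p : ℕ → ℝ, DickeSep.IsState (DickeSep.dickeDiag N p) →
      DickeSep.reductionMap N α (DickeSep.dickeDiag N p) =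
        DickeSep.dickeDiag N (fun k => 1 + α * p k)) ∧
    -- positivity of the two Hankel matrices gives separability of the image
    (∀ p : ℕ → ℝ, DickeSep.IsState (DickeSep.dickeDiag N p) →
      (DickeSep.hankel N 0 (fun k => 1 + α * p k)).PosSemidef →
      (DickeSep.hankel N 1 (fun k => 1 + α * p k)).PosSemidef →
      DickeSep.IsSeparable (DickeSep.reductionMap N α (DickeSep.dickeDiag N p))) ∧
    -- invertibility, and the separability criterion through the inverse map:
    -- first for a single preimage state, then for an `α` that is admissible for all states
    (α ≠ 0 → (N : ℝ) + 1 + α ≠ 0 →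
      IsUnit (DickeSep.reductionMap N α) ∧
      (∀ q p : ℕ → ℝ, (DickeSep.dickeDiag N q).PosSemidef →
        Ring.inverse (DickeSep.reductionMap N α) (DickeSep.dickeDiag N q) =
          DickeSep.dickeDiag N p →
        DickeSep.IsState (DickeSep.dickeDiag N p) →
        (DickeSep.hankel N 0 (fun k => 1 + α * p k)).PosSemidef →
        (DickeSep.hankel N 1 (fun k => 1 + α * p k)).PosSemidef →
        DickeSep.IsSeparable (DickeSep.dickeDiag N q)) ∧
      ((∀ p : ℕ → ℝ, DickeSep.IsState (DickeSep.dickeDiag N p) →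
          (DickeSep.hankel N 0 (fun k => 1 + α * p k)).PosSemidef ∧
          (DickeSep.hankel N 1 (fun k => 1 + α * p k)).PosSemidef) →
        ∀ q : ℕ → ℝ, (DickeSep.dickeDiag N q).PosSemidef →
          (Ring.inverse (DickeSep.reductionMap N α) (DickeSep.dickeDiag N q)).PosSemidef →
          DickeSep.IsSeparable (DickeSep.dickeDiag N q))) := by
  have sum_eq_one : ∀ p : ℕ → ℝ, DickeSep.IsState (DickeSep.dickeDiag N p) →
      ∑ j ∈ Finset.range (N + 1), p j = 1 := fun p hp => by
    have h := hp.2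
    rw [DickeSep.trace_dickeDiag] at h
    exact_mod_cast h
  have action : ∀ p : ℕ → ℝ, DickeSep.IsState (DickeSep.dickeDiag N p) →
      DickeSep.reductionMap N α (DickeSep.dickeDiag N p) =
        DickeSep.dickeDiag N (fun k => 1 + α * p k) := fun p hp => by
    rw [DickeSep.reductionMap_dickeDiag, sum_eq_one p hp]
  have separable : ∀ p : ℕ → ℝ, DickeSep.IsState (DickeSep.dickeDiag N p) →
      (DickeSep.hankel N 0 (fun k => 1 + α * p k)).PosSemidef →
      (DickeSep.hankel N 1 (fun k => 1 + α * p k)).PosSemidef →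
      DickeSep.IsSeparable (DickeSep.reductionMap N α (DickeSep.dickeDiag N p)) :=
    fun p hp h0 h1 => by
      rw [action p hp]
      exact DickeSep.isSeparable_dickeDiag hN h0 h1
  refine ⟨action, separable, fun hα hα' => ?_⟩
  have hunit := DickeSep.isUnit_reductionMap hα hα'
  refine ⟨hunit, fun q p _ hinv hp h0 h1 => ?_, fun hadm q _ hpos => ?_⟩
  · have h := congrArg (DickeSep.reductionMap N α) hinv
    rw [← Module.End.mul_apply, Ring.mul_inverse_cancel _ hunit, Module.End.one_apply] at h
    rw [h]
    exact separable p hp h0 h1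
  · -- Taking traces in `Λ_α(ρ_DS(p)) = ρ_DS(q)` shows that the preimage has trace `c`; solving for
    -- the coefficients then gives `p`.
    set c := (∑ j ∈ Finset.range (N + 1), q j) / ((N : ℝ) + 1 + α) with hc
    set p : ℕ → ℝ := fun k => (q k - c) / α with hp
    have hsum : ∑ j ∈ Finset.range (N + 1), p j = c := by
      have h : ∑ j ∈ Finset.range (N + 1), q j = c * ((N : ℝ) + 1 + α) := by
        rw [hc, div_mul_cancel₀ _ hα']
      rw [hp, ← Finset.sum_div, Finset.sum_sub_distrib, h, Finset.sum_const, Finset.card_range,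
        nsmul_eq_mul, div_eq_iff hα]
      push_cast
      ring
    have himage : DickeSep.reductionMap N α (DickeSep.dickeDiag N p) = DickeSep.dickeDiag N q := by
      rw [DickeSep.reductionMap_dickeDiag, hsum]
      congr 1
      funext k
      rw [hp, mul_div_cancel₀ _ hα]
      ring
    have hinv : Ring.inverse (DickeSep.reductionMap N α) (DickeSep.dickeDiag N q) =
        DickeSep.dickeDiag N p := by
      rw [← himage, ← Module.End.mul_apply, Ring.inverse_mul_cancel _ hunit, Module.End.one_apply]
    rw [hinv] at hpos
    have htrace : (DickeSep.dickeDiag N p).trace = (c : ℂ) := by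
      rw [DickeSep.trace_dickeDiag, hsum]
    have hc0 : 0 ≤ c := by
      have h := hpos.trace_nonneg
      rw [htrace] at h
      exact_mod_cast h
    rw [← himage]
    rcases hc0.eq_or_lt with h | hcpos
    · rw [hpos.trace_eq_zero_iff.1 (by rw [htrace, ← h, Complex.ofReal_zero]), map_zero]
      exact DickeSep.isSeparable_zero N
    · have hscale : DickeSep.dickeDiag N p =
          (c : ℂ) • DickeSep.dickeDiag N (fun k => c⁻¹ * p k) := by
        rw [← DickeSep.dickeDiag_smul]
        congr 1
        funext k
        rw [mul_inv_cancel_left₀ hcpos.ne']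
      have hstate : DickeSep.IsState (DickeSep.dickeDiag N (fun k => c⁻¹ * p k)) := by
        refine ⟨?_, ?_⟩
        · rw [DickeSep.dickeDiag_smul]
          exact hpos.smul (by exact_mod_cast (inv_pos.2 hcpos).le)
        · rw [DickeSep.trace_dickeDiag, ← Finset.mul_sum, hsum, inv_mul_cancel₀ hcpos.ne',
            Complex.ofReal_one]
      rw [hscale, map_smul]
      exact (separable _ hstate (hadm _ hstate).1 (hadm _ hstate).2).smul hc0
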